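/- For $n\ge 0$ and a permutation $\pi=\pi_1\pi_2\cdots\pi_n$ of $[n]=\{1,\dots,n\}$, an index $i$ with $1\le i<n$ is an exterior peak if $i=1$ and $\pi_1>\pi_2$, or if $1<i<n$ and $\pi_{i-1}<\pi_i>\pi_{i+1}$; an index $i$ with $3\le i\le n$ is a proper double descent if $\pi_{i-2}>\pi_{i-1}>\pi_i$. Let $P_n(i,j)$ be the number of permutations of $[n]$ with $i$ exterior peaks and $j$ proper double descents, $T(n,k)$ the number of those with $k$ exterior peaks, and $U(n,k)$ the number of those with $k$ proper double descents (for $n=0$ the empty permutation is counted, so $P_0(0,0)=1$). Put $$P_n(x,y)=\sum_{i,j\ge 0}P_n(i,j)x^iy^j,\qquad T_n(x)=\sum_{k\ge 0}T(n,k)x^k,\qquad U_n(y)=\sum_{k\ge 0}U(n,k)y^k .$$ (a) Let $K$ be a field of characteristic $0$ and let $x,y,\Delta\in K$ with $\Delta^2=(1+y)^2-4x$ and $\Delta\neq 0$ (for instance, $x,y$ indeterminates and $\Delta=\sqrt{(1+y)^2-4x}$). Then in $K[[t]]$ the denominator below is invertible and $$\sum_{n=0}^{\infty}P_n(x,y)\frac{t^n}{n!}=\frac{2\Delta\,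 e^{\frac t2(1-y+\Delta)}}{1+y+\Delta-(1+y-\Delta)e^{t\Delta}} .$$ If $K=\mathbb C$, then for all complex $t$ in a neighbourhood of $0$ (depending on $x,y,\Delta$) the denominator is nonzero, the series converges, and the identity holds between complex numbers. (b) For every $n\ge 0$, $P_n(x,1)=T_n(x)$, $P_n(1,y)=U_n(y)$ and $P_n(1,0)=U(n,0)$, with $x,y$ in any commutative semiring, and the formula specializes to the following ones. In each, the identity holds, with a nonzero denominator and a convergent series, for all complex $t$ in a neighbourhood of $0$ (depending on the parameters). Gessel: for $x,s\in\mathbb C$ with $s^2=1-x$, $s\ne 0$, $$\sum_{n=0}^\infty \frac{T_n(x)t^n}{n!}=\frac{s}{s\cosh(ts)-\sinh(ts)} .$$ Elizalde and Noy: for $y,\delta\in\mathbb C$ with $\delta^2=(y-1)(y+3)$, $\delta\neq0$, $$\sum_{n=0}^\infty \frac{U_n(y)t^n}{n!}=\frac{2\delta\, e^{\frac t2(1-y+\delta)}}{1+y+\delta-(1+y-\delta)e^{t\delta}} .$$ Elizalde and Noy, Barry, Basset: $$\sum_{n=0}^{\infty}U(n,0)\frac{t^n}{n!}=\frac{\sqrt{3}}{2}\,\frac{e^{t/2}}{\cos\left(\sqrt{3}\,t/2+\pi/6\right)}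 .$$ -/

import Mathlib

open scoped Topology Nat

/-- A permutation `π` on `[n]` is a bijection of `Fin n`; the letter `π_i` of the word
`π_1 π_2 ⋯ π_n` is the value of `π` at the position `i - 1`.  The position `i` is an exterior peak
if it has a right neighbour, which carries a smaller letter, and its left neighbour, if there is
one, carries a smaller letter too: `π_1 > π_2` for the first position, and
`π_{i-1} < π_i > π_{i+1}` for an interior one.  The last position is never an exterior peak. -/
def IsExteriorPeak {n : ℕ} (π : Equiv.Perm (Fin n)) (i : Fin n) : Prop :=
  (∃ k : Fin n, (k : ℕ) = (i : ℕ) + 1 ∧ π k < π i) ∧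
    ∀ k : Fin n, (k : ℕ) + 1 = (i : ℕ) → π k < π i

/-- The position `i` is a proper double descent of `π`: it has two predecessors, and
`π_{i-2} > π_{i-1} > π_i`. -/
def IsProperDoubleDescent {n : ℕ} (π : Equiv.Perm (Fin n)) (i : Fin n) : Prop :=
  ∃ j k : Fin n, (k : ℕ) + 1 = (j : ℕ) ∧ (j : ℕ) + 1 = (i : ℕ) ∧ π j < π k ∧ π i < π j

instance {n : ℕ} (π : Equiv.Perm (Fin n)) : DecidablePred (IsExteriorPeak π) := fun i => by
  unfold IsExteriorPeak; infer_instance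

instance {n : ℕ} (π : Equiv.Perm (Fin n)) : DecidablePred (IsProperDoubleDescent π) := fun i => by
  unfold IsProperDoubleDescent; infer_instance

/-- The number of exterior peaks of `π`. -/
def exteriorPeaks {n : ℕ} (π : Equiv.Perm (Fin n)) : ℕ :=
  (Finset.univ.filter (IsExteriorPeak π)).card

/-- The number of proper double descents of `π`. -/
def properDoubleDescents {n : ℕ} (π : Equiv.Perm (Fin n)) : ℕ :=
  (Finset.univ.filter (IsProperDoubleDescent π)).card

/-- `P_n(i, j)`: the number of permutations on `[n]` with `i` exterior peaks and `j` proper double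
descents. -/
def countP (n i j : ℕ) : ℕ :=
  (Finset.univ.filter fun π : Equiv.Perm (Fin n) =>
    exteriorPeaks π = i ∧ properDoubleDescents π = j).card

/-- `T(n, k)`: the number of permutations on `[n]` with `k` exterior peaks. -/
def countT (n k : ℕ) : ℕ :=
  (Finset.univ.filter fun π : Equiv.Perm (Fin n) => exteriorPeaks π = k).card

/-- `U(n, k)`: the number of permutations on `[n]` with `k` proper double descents. -/
def countU (n k : ℕ) : ℕ :=
  (Finset.univ.filter fun π : Equiv.Perm (Fin n) => properDoubleDescents π = k).card

/-- The polynomial `P_n(x, y) = ∑_{i, j} P_n(i, j) x^i y^j`, evaluated in a commutative semiring.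
Both statistics are at most `n`, so the sum has all the nonzero terms. -/
def polyP {R : Type*} [CommSemiring R] (n : ℕ) (x y : R) : R :=
  ∑ i ∈ Finset.range (n + 1), ∑ j ∈ Finset.range (n + 1), (countP n i j : R) * x ^ i * y ^ j

/-- The polynomial `T_n(x) = ∑_k T(n, k) x^k`. -/
def polyT {R : Type*} [CommSemiring R] (n : ℕ) (x : R) : R :=
  ∑ k ∈ Finset.range (n + 1), (countT n k : R) * x ^ k

/-- The polynomial `U_n(y) = ∑_k U(n, k) y^k`. -/
def polyU {R : Type*} [CommSemiring R] (n : ℕ) (y : R) : R :=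
  ∑ k ∈ Finset.range (n + 1), (countU n k : R) * y ^ k

/-- The formal power series `e^{a t}` in `t` over a field of characteristic zero. -/
noncomputable def expSeries {K : Type*} [Field K] [CharZero K] (a : K) : PowerSeries K :=
  PowerSeries.mk fun n => a ^ n / (n ! : K)

/-! Put a letter `0`, smaller than all others, in front of the word of a permutation. Every window
`a b c` of three consecutive letters then has weight `x` if `b` is a peak, `y` if the window
descends twice, and `1` otherwise; the product of these weights is `x ^ exteriorPeaks π * y ^
properDoubleDescents π` (`openWt_permWord`). Let `openWt` be this weight and `closedWt` the weight
with a `0` at the end as well.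

Cut a word at its minimum `m`, as `σ m τ`. Towards both sides `m` acts like the bottom letter, so
the weight factors: open = closed(`σ`) · open(`τ`), and closed = closed(`σ`) · closed(`τ`) except
when `τ` is empty, where the last window gives `y`, or `x` if `σ` is empty too. For the exponential
generating functions `O` and `C` this says `O' = C O` and `C' = C² - (1 - y) C + (x - y)`, with
`O(0) = C(0) = 1` (`derivative_egf_openNum`, `derivative_egf_closedNum`).

The Riccati equation has the constant solution `r = (1 - y + Δ) / 2`. With `D` the denominator, `C -
r = -D' / D`, hence `O = 2Δ e^{rt} / D`. Both facts are proved without division or integration, by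
showing that a difference solves a homogeneous linear equation with initial value zero
(`eq_zero_of_derivative_eq_mul`). The complex identities follow by evaluating `O D = 2Δ e^{rt}` at
small `t`; the named formulas are specializations. -/

/-! ### Words on a finite set of letters, and cutting them at a letter. -/

section Words

/-- The words in which every element of `S` occurs exactly once. -/
noncomputable def words (S : Finset ℕ) : Finset (List ℕ) := S.toList.permutations.toFinset

theorem mem_words {S : Finset ℕ} {l : List ℕ} : l ∈ words S ↔ l.Nodup ∧ l.toFinset = S := by
  rw [words, List.mem_toFinset, List.mem_permutations]
  constructor
  · intro h
    refine ⟨h.nodup_iff.2 S.nodup_toList, ?_⟩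
    rw [List.toFinset_eq_of_perm _ _ h, Finset.toList_toFinset]
  · rintro ⟨h, rfl⟩
    exact (List.perm_ext_iff_of_nodup h (Finset.nodup_toList _)).2 (by simp)

theorem words_empty : words ∅ = {[]} := by
  simp [words]

/-- A word on `S` is split at its letter `m` into a word on a subset of `S \ {m}` and a word on the
complement of this subset. -/
theorem sum_words_split {R : Type*} [AddCommMonoid R] {S : Finset ℕ} {m : ℕ} (hm : m ∈ S)
    (F : List ℕ → R) :
    ∑ l ∈ words S, F l = ∑ A ∈ (S.erase m).powerset, ∑ σ ∈ words A,
      ∑ τ ∈ words (S.erase m \ A), F (σ ++ m :: τ) := by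
  simp_rw [← Finset.sum_product', Finset.sum_sigma']
  symm
  refine Finset.sum_bij (fun p _ => p.2.1 ++ m :: p.2.2) ?_ ?_ ?_ (fun _ _ => rfl)
  · rintro ⟨A, σ, τ⟩ h
    simp only [Finset.mem_sigma, Finset.mem_powerset, Finset.mem_product, mem_words] at h
    obtain ⟨hA, ⟨hσ, rfl⟩, hτ, hτ'⟩ := h
    have h1 : ∀ a, a ∈ σ → a ∈ S ∧ a ≠ m := fun a ha => by
      have := hA (List.mem_toFinset.2 ha); simpa [and_comm] using this
    have h2 : ∀ a, a ∈ τ ↔ (a ≠ m ∧ a ∈ S) ∧ a ∉ σ := fun a => by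
      rw [← List.mem_toFinset, hτ']; simp
    refine mem_words.2 ⟨?_, ?_⟩
    · rw [List.nodup_append]
      refine ⟨hσ, List.nodup_cons.2 ⟨fun h => ((h2 m).1 h).1.1 rfl, hτ⟩, ?_⟩
      intro a ha b hb
      rcases List.mem_cons.1 hb with rfl | hb
      · exact (h1 a ha).2
      · rintro rfl; exact ((h2 a).1 hb).2 ha
    · ext a
      simp only [List.toFinset_append, List.toFinset_cons, Finset.mem_union, List.mem_toFinset,
        Finset.mem_insert, h2]
      by_cases h : a = m
      · simp [h, hm]
      · have := h1 a
        tauto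
  · rintro ⟨A, σ, τ⟩ h ⟨A', σ', τ'⟩ h' e
    simp only [Finset.mem_sigma, Finset.mem_powerset, Finset.mem_product, mem_words] at h h'
    obtain ⟨hA, ⟨hσ, rfl⟩, hτ, hτ'⟩ := h
    obtain ⟨hA', ⟨hσ', rfl⟩, hτ2, hτ2'⟩ := h'
    have n1 : m ∉ σ' := fun h => by
      have := hA' (List.mem_toFinset.2 h); simp at this
    have n2 : m ∉ τ := fun h => by
      have := hτ' ▸ (List.mem_toFinset.2 h); simp at this
    obtain ⟨rfl, -, rfl⟩ := (List.append_cons_inj_of_notMem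
      (fun h => by have := hA (List.mem_toFinset.2 h); simp at this) n2).1 e
    rfl
  · intro l hl
    obtain ⟨hnd, rfl⟩ := mem_words.1 hl
    obtain ⟨σ, τ, rfl⟩ := List.append_of_mem (List.mem_toFinset.1 hm)
    have hn := List.nodup_append.1 hnd
    have hn2 := List.nodup_cons.1 hn.2.1
    have hmσ : m ∉ σ := fun h => hn.2.2 m h m (by simp) rfl
    refine ⟨⟨σ.toFinset, σ, τ⟩, ?_, rfl⟩
    simp only [Finset.mem_sigma, Finset.mem_powerset, Finset.mem_product, mem_words]
    refine ⟨?_, ⟨hn.1, trivial⟩, hn2.2, ?_⟩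
    · intro a ha
      have ha' := List.mem_toFinset.1 ha
      simp only [Finset.mem_erase, List.mem_toFinset, List.mem_append]
      exact ⟨fun h => hmσ (h ▸ ha'), Or.inl ha'⟩
    · ext a
      have h3 : a ∈ τ → a ∉ σ := fun h h' => hn.2.2 a h' a (by simp [h]) rfl
      have h4 : a ∈ τ → a ≠ m := fun h h' => hn2.1 (h' ▸ h)
      simp only [List.mem_toFinset, Finset.mem_sdiff, Finset.mem_erase, List.mem_append,
        List.mem_cons]
      tauto

end Words

/-! ### Window weights and their factorization at the smallest letter. -/

section Weight

variable {R : Type*} [CommSemiring R] (x y : R)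

/-- The weight of the window `a b c`: `x` if `b` is a peak, `y` if it is in a double descent. -/
def centerWt (a b c : ℕ) : R := if c < b then if a < b then x else y else 1

/-- The product of the weights of all windows of three letters in a word. -/
def windowWt : List ℕ → R
  | a :: b :: c :: l => centerWt x y a b c * windowWt (b :: c :: l)
  | _ => 1

theorem windowWt_cons_cons_cons (a b c : ℕ) (l : List ℕ) :
    windowWt x y (a :: b :: c :: l) = centerWt x y a b c * windowWt x y (b :: c :: l) := by
  rw [windowWt]

theorem windowWt_pair (a b : ℕ) : windowWt x y [a, b] = 1 := by
  simp [windowWt]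

theorem windowWt_singleton (a : ℕ) : windowWt x y [a] = 1 := by
  simp [windowWt]

/-- A word is cut at a letter `m` that is followed by a larger letter. -/
theorem windowWt_append_of_lt {m c : ℕ} (h : m < c) (v : List ℕ) : ∀ u : List ℕ,
    windowWt x y (u ++ m :: c :: v) = windowWt x y (u ++ [m]) * windowWt x y (m :: c :: v)
  | [] => by simp [windowWt_singleton]
  | [a] => by
      simp [windowWt_pair, windowWt_cons_cons_cons, centerWt, h.not_gt]
  | [a, b] => by
      have := windowWt_append_of_lt h v [b]
      simp only [List.cons_append, List.nil_append, windowWt_cons_cons_cons x y a] at this ⊢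
      rw [this, mul_assoc]
  | a :: b :: b' :: u => by
      have := windowWt_append_of_lt h v (b :: b' :: u)
      simp only [List.cons_append, windowWt_cons_cons_cons x y a] at this ⊢
      rw [this, mul_assoc]

theorem windowWt_cons_congr {a a' b : ℕ} (h : a < b) (h' : a' < b) :
    ∀ l : List ℕ, windowWt x y (a :: b :: l) = windowWt x y (a' :: b :: l)
  | [] => by simp [windowWt_pair]
  | c :: l => by simp [windowWt_cons_cons_cons, centerWt, h, h']

/-- The last letter enters only the final window, and there only through its comparison with the
letter before it. -/
theorem windowWt_append_congr {m m' : ℕ} : ∀ u : List ℕ, (∀ b ∈ u.getLast?, m < b ∧ m' < b) →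
    windowWt x y (u ++ [m]) = windowWt x y (u ++ [m'])
  | [], _ => by simp [windowWt_singleton]
  | [a], _ => by simp [windowWt_pair]
  | [a, b], h => by
      have := h b (by simp)
      simp [windowWt_cons_cons_cons, windowWt_pair, centerWt, this]
  | a :: b :: c :: u, h => by
      have := windowWt_append_congr (m := m) (m' := m') (b :: c :: u) (fun d hd => h d (by
        simpa using hd))
      simp only [List.cons_append, windowWt_cons_cons_cons x y a] at this ⊢
      rw [this]

theorem windowWt_append_three {a b c : ℕ} : ∀ u : List ℕ,
    windowWt x y (u ++ [a, b, c]) = windowWt x y (u ++ [a, b]) * centerWt x y a b c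
  | [] => by simp [windowWt_pair, windowWt_cons_cons_cons]
  | [d] => by simp [windowWt_pair, windowWt_cons_cons_cons]
  | d :: e :: u => by
      have := windowWt_append_three (a := a) (b := b) (c := c) (e :: u)
      cases u <;>
      · simp only [List.cons_append, List.nil_append, windowWt_cons_cons_cons x y d] at this ⊢
        rw [this, mul_assoc]

/-- The bottom letter `0` in front of the word. -/
def openWt (l : List ℕ) : R := windowWt x y (0 :: l)

/-- The bottom letter `0` on both sides of the word. -/
def closedWt (l : List ℕ) : R := windowWt x y (0 :: (l ++ [0]))

variable {m : ℕ} {σ τ : List ℕ}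

/-- A letter below all of `σ` closes `σ` just as the bottom letter does. -/
theorem windowWt_bot_append (hm : 0 < m) (hσ : ∀ a ∈ σ, m < a) :
    windowWt x y (0 :: (σ ++ [m])) = closedWt x y σ := by
  rcases σ.eq_nil_or_concat with rfl | ⟨σ', b, rfl⟩
  · simp [closedWt, windowWt_pair]
  · rw [List.concat_eq_append] at *
    refine windowWt_append_congr x y (0 :: (σ' ++ [b])) fun d hd => ?_
    have : d = b := by
      rw [← List.cons_append, List.getLast?_concat] at hd
      simpa [eq_comm] using hd
    have := hσ b (by simp)
    omega

/-- The minimum ends `σ` and starts `τ` in the role of `0`; the window centred at it, if there is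
one, ascends into `τ` and has weight `1`. -/
theorem openWt_split (hm : 0 < m) (hσ : ∀ a ∈ σ, m < a) (hτ : ∀ a ∈ τ, m < a) :
    openWt x y (σ ++ m :: τ) = closedWt x y σ * openWt x y τ := by
  rw [← windowWt_bot_append x y hm hσ]
  cases τ with
  | nil => simp [openWt, windowWt_singleton]
  | cons c τ =>
    have hc := hτ c (by simp)
    have := windowWt_append_of_lt x y hc τ (0 :: σ)
    rw [openWt, openWt, windowWt_cons_congr x y (hm.trans hc) hc]
    simpa using this

theorem closedWt_split (hm : 0 < m) (hσ : ∀ a ∈ σ, m < a) (hτ : ∀ a ∈ τ, m < a) (h : τ ≠ []) :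
    closedWt x y (σ ++ m :: τ) = closedWt x y σ * closedWt x y τ := by
  rw [← windowWt_bot_append x y hm hσ]
  cases τ with
  | nil => exact absurd rfl h
  | cons c τ =>
    have hc := hτ c (by simp)
    have := windowWt_append_of_lt x y hc (τ ++ [0]) (0 :: σ)
    rw [closedWt, closedWt, List.cons_append, windowWt_cons_congr x y (hm.trans hc) hc]
    simpa using this

/-- The additional factor comes from the window `b m 0`, a double descent, where `b` is the last
letter of `σ`. -/
theorem closedWt_append_singleton (hm : 0 < m) (hσ : ∀ a ∈ σ, m < a) (h : σ ≠ []) :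
    closedWt x y (σ ++ [m]) = y * closedWt x y σ := by
  rw [← windowWt_bot_append x y hm hσ]
  rcases σ.eq_nil_or_concat with rfl | ⟨σ', b, rfl⟩
  · exact absurd rfl h
  · rw [List.concat_eq_append] at *
    have hb := hσ b (by simp)
    have := windowWt_append_three x y (a := b) (b := m) (c := 0) (0 :: σ')
    have h2 : centerWt x y b m 0 = y := by simp [centerWt, hm, hb.not_gt]
    rw [h2, mul_comm] at this
    simpa [closedWt] using this

theorem closedWt_singleton (hm : 0 < m) : closedWt x y [m] = x := by
  simp [closedWt, windowWt_cons_cons_cons, windowWt_pair, centerWt, hm]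

theorem closedWt_nil : closedWt x y [] = 1 := by simp [closedWt, windowWt_pair]

theorem openWt_nil : openWt x y [] = 1 := by simp [openWt, windowWt_singleton]

end Weight

/-! ### Recursions for the total weights. -/

section Sums

variable {R : Type*} [CommRing R] (x y : R)

/-- The sum of the weights `openWt` of the words on `S`. -/
noncomputable def openSum (S : Finset ℕ) : R := ∑ l ∈ words S, openWt x y l

/-- The sum of the weights `closedWt` of the words on `S`. -/
noncomputable def closedSum (S : Finset ℕ) : R := ∑ l ∈ words S, closedWt x y l

theorem openSum_empty : openSum x y ∅ = 1 := by simp [openSum, words_empty, openWt_nil]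

theorem closedSum_empty : closedSum x y ∅ = 1 := by simp [closedSum, words_empty, closedWt_nil]

theorem lt_of_mem_words {S A : Finset ℕ} {m : ℕ} (hmin : ∀ a ∈ S, m ≤ a)
    (hA : A ⊆ S.erase m) {l : List ℕ} (hl : l ∈ words A) : ∀ a ∈ l, m < a := by
  intro a ha
  rw [mem_words] at hl
  have h := hA (hl.2 ▸ List.mem_toFinset.2 ha)
  rw [Finset.mem_erase] at h
  exact lt_of_le_of_ne (hmin a h.2) h.1.symm

theorem ne_nil_of_mem_words {A : Finset ℕ} (hA : A ≠ ∅) {l : List ℕ} (hl : l ∈ words A) :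
    l ≠ [] := by
  rintro rfl
  exact hA (mem_words.1 hl).2.symm

theorem openSum_split {S : Finset ℕ} {m : ℕ} (hm : m ∈ S) (hm0 : 0 < m) (hmin : ∀ a ∈ S, m ≤ a) :
    openSum x y S =
      ∑ A ∈ (S.erase m).powerset, closedSum x y A * openSum x y (S.erase m \ A) := by
  rw [openSum, sum_words_split hm]
  refine Finset.sum_congr rfl fun A hA => ?_
  rw [closedSum, openSum, Finset.sum_mul_sum]
  refine Finset.sum_congr rfl fun σ hσ => Finset.sum_congr rfl fun τ hτ => ?_
  exact openWt_split x y hm0 (lt_of_mem_words hmin (Finset.mem_powerset.1 hA) hσ)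
    (lt_of_mem_words hmin Finset.sdiff_subset hτ)

/-- The part of a word on `S` before its minimum `m`, the part after it, and the two exceptional
cases in which there is nothing after `m`. -/
theorem closedSum_split {S : Finset ℕ} {m : ℕ} (hm : m ∈ S) (hm0 : 0 < m)
    (hmin : ∀ a ∈ S, m ≤ a) :
    closedSum x y S =
      ∑ A ∈ (S.erase m).powerset, closedSum x y A * closedSum x y (S.erase m \ A)
        - (1 - y) * closedSum x y (S.erase m) + if S.erase m = ∅ then x - y else 0 := by
  set B := S.erase m with hB
  have hBmem : B ∈ B.powerset := Finset.mem_powerset_self B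
  -- The term `A = B` is the one with nothing after `m`, where the product formula fails; it is
  -- separated from both sums.
  rw [closedSum, sum_words_split hm, ← hB, ← Finset.sum_erase_add _ _ hBmem,
    ← Finset.sum_erase_add _ _ hBmem]
  have h1 : ∑ A ∈ B.powerset.erase B, ∑ σ ∈ words A, ∑ τ ∈ words (B \ A),
      closedWt x y (σ ++ m :: τ) =
      ∑ A ∈ B.powerset.erase B, closedSum x y A * closedSum x y (B \ A) := by
    refine Finset.sum_congr rfl fun A hA => ?_
    rw [Finset.mem_erase, Finset.mem_powerset] at hA
    rw [closedSum, closedSum, Finset.sum_mul_sum]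
    refine Finset.sum_congr rfl fun σ hσ => Finset.sum_congr rfl fun τ hτ => ?_
    refine closedWt_split x y hm0 (lt_of_mem_words hmin hA.2 hσ)
      (lt_of_mem_words hmin Finset.sdiff_subset hτ) (ne_nil_of_mem_words ?_ hτ)
    intro h
    exact hA.1 (hA.2.antisymm (Finset.sdiff_eq_empty_iff_subset.1 h))
  rw [h1, Finset.sdiff_self, closedSum_empty]
  simp only [words_empty, Finset.sum_singleton]
  by_cases hBe : B = ∅
  · rw [if_pos hBe, hBe, words_empty, Finset.sum_singleton, closedSum_empty, List.nil_append,
      closedWt_singleton x y hm0]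
    ring
  · have h2 : ∑ σ ∈ words B, closedWt x y (σ ++ [m]) = y * closedSum x y B := by
      rw [closedSum, Finset.mul_sum]
      exact Finset.sum_congr rfl fun σ hσ => closedWt_append_singleton x y hm0
        (lt_of_mem_words hmin subset_rfl hσ) (ne_nil_of_mem_words hBe hσ)
    rw [if_neg hBe, h2]
    ring

/-- The closed sum over the words on `[n]`. -/
noncomputable def closedNum (n : ℕ) : R := closedSum x y (Finset.Icc 1 n)

/-- The open sum over the words on `[n]`. -/
noncomputable def openNum (n : ℕ) : R := openSum x y (Finset.Icc 1 n)

theorem sum_powerset_card_mul (B : Finset ℕ) (f g : ℕ → R) :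
    ∑ A ∈ B.powerset, f A.card * g (B \ A).card =
      ∑ k ∈ Finset.range (B.card + 1), (B.card.choose k : R) * (f k * g (B.card - k)) := by
  have h : ∀ A ∈ B.powerset, f A.card * g (B \ A).card =
      (fun k => f k * g (B.card - k)) A.card := fun A hA => by
    simp only [Finset.card_sdiff_of_subset (Finset.mem_powerset.1 hA)]
  rw [Finset.sum_congr rfl h, Finset.sum_powerset_apply_card (fun k => f k * g (B.card - k))]
  simp [nsmul_eq_mul]

/-- The recursion, given the value for all smaller sets. -/
theorem closedSum_eq_of_lt {S : Finset ℕ} {n : ℕ} (h0 : 0 ∉ S) (hS : S.card = n + 1)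
    (ih : ∀ A : Finset ℕ, 0 ∉ A → A.card ≤ n → closedSum x y A = closedNum x y A.card) :
    closedSum x y S =
      ∑ k ∈ Finset.range (n + 1), (n.choose k : R) * (closedNum x y k * closedNum x y (n - k))
        - (1 - y) * closedNum x y n + if n = 0 then x - y else 0 := by
  have hne : S.Nonempty := Finset.card_pos.1 (by omega)
  have hm := S.min'_mem hne
  have hm0 : 0 < S.min' hne := Nat.pos_of_ne_zero fun h => h0 (h ▸ hm)
  have hc : (S.erase (S.min' hne)).card = n := by rw [Finset.card_erase_of_mem hm, hS]; rfl
  have ih' : ∀ A ⊆ S.erase (S.min' hne), closedSum x y A = closedNum x y A.card := fun A hA =>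
    ih A (fun h => h0 (Finset.mem_of_mem_erase (hA h))) (hc ▸ Finset.card_le_card hA)
  rw [closedSum_split x y hm hm0 (fun a ha => S.min'_le a ha), ih' _ subset_rfl, hc]
  have e : (S.erase (S.min' hne) = ∅) = (n = 0) := by
    rw [← Finset.card_eq_zero, hc]
  rw [← hc, ← sum_powerset_card_mul, hc]
  simp only [e]
  congr 2
  exact Finset.sum_congr rfl fun A hA => by
    rw [ih' A (Finset.mem_powerset.1 hA), ih' _ Finset.sdiff_subset]

/-- Only the order of the letters matters: the recursion expresses the sum through the size of `S`
alone, so `S` and the interval of the same size get the same value. -/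
theorem closedSum_eq (S : Finset ℕ) (h0 : 0 ∉ S) : closedSum x y S = closedNum x y S.card := by
  induction hn : S.card using Nat.strong_induction_on generalizing S with
  | _ n ih =>
    cases n with
    | zero => rw [Finset.card_eq_zero.1 hn, closedNum]; simp
    | succ n =>
      have ih' : ∀ A : Finset ℕ, 0 ∉ A → A.card ≤ n →
          closedSum x y A = closedNum x y A.card := fun A hA hc =>
        ih A.card (by omega) A hA rfl
      exact (closedSum_eq_of_lt x y h0 hn ih').trans
        (closedSum_eq_of_lt x y (S := Finset.Icc 1 (n + 1)) (by simp) (by simp) ih').symm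

theorem closedNum_zero : closedNum x y 0 = 1 := by simp [closedNum, closedSum_empty]

theorem openNum_zero : openNum x y 0 = 1 := by simp [openNum, openSum_empty]

theorem closedNum_succ (n : ℕ) : closedNum x y (n + 1) =
    ∑ k ∈ Finset.range (n + 1), (n.choose k : R) * (closedNum x y k * closedNum x y (n - k))
      - (1 - y) * closedNum x y n + if n = 0 then x - y else 0 :=
  closedSum_eq_of_lt x y (by simp) (by simp) fun A hA _ => closedSum_eq x y A hA

theorem openSum_eq_of_lt {S : Finset ℕ} {n : ℕ} (h0 : 0 ∉ S) (hS : S.card = n + 1)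
    (ih : ∀ A : Finset ℕ, 0 ∉ A → A.card ≤ n → openSum x y A = openNum x y A.card) :
    openSum x y S =
      ∑ k ∈ Finset.range (n + 1), (n.choose k : R) * (closedNum x y k * openNum x y (n - k)) := by
  have hne : S.Nonempty := Finset.card_pos.1 (by omega)
  have hm := S.min'_mem hne
  have hm0 : 0 < S.min' hne := Nat.pos_of_ne_zero fun h => h0 (h ▸ hm)
  have hc : (S.erase (S.min' hne)).card = n := by rw [Finset.card_erase_of_mem hm, hS]; rfl
  have hz : ∀ A ⊆ S.erase (S.min' hne), 0 ∉ A := fun A hA h =>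
    h0 (Finset.mem_of_mem_erase (hA h))
  rw [openSum_split x y hm hm0 (fun a ha => S.min'_le a ha), ← hc, ← sum_powerset_card_mul]
  exact Finset.sum_congr rfl fun A hA => by
    rw [closedSum_eq x y A (hz A (Finset.mem_powerset.1 hA)),
      ih _ (hz _ Finset.sdiff_subset) (hc ▸ Finset.card_le_card Finset.sdiff_subset)]

theorem openSum_eq (S : Finset ℕ) (h0 : 0 ∉ S) : openSum x y S = openNum x y S.card := by
  induction hn : S.card using Nat.strong_induction_on generalizing S with
  | _ n ih =>
    cases n with
    | zero => rw [Finset.card_eq_zero.1 hn, openNum]; simp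
    | succ n =>
      have ih' : ∀ A : Finset ℕ, 0 ∉ A → A.card ≤ n →
          openSum x y A = openNum x y A.card := fun A hA hc =>
        ih A.card (by omega) A hA rfl
      exact (openSum_eq_of_lt x y h0 hn ih').trans
        (openSum_eq_of_lt x y (S := Finset.Icc 1 (n + 1)) (by simp) (by simp) ih').symm

theorem openNum_succ (n : ℕ) : openNum x y (n + 1) =
    ∑ k ∈ Finset.range (n + 1), (n.choose k : R) * (closedNum x y k * openNum x y (n - k)) :=
  openSum_eq_of_lt x y (by simp) (by simp) fun A hA _ => openSum_eq x y A hA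

end Sums

/-! ### Permutations as words, and their statistics as window weights. -/

section Permutations

/-- The word of a permutation, with the letters `1, …, n`. -/
def permWord {n : ℕ} (π : Equiv.Perm (Fin n)) : List ℕ := List.ofFn fun i => (π i : ℕ) + 1

theorem permWord_injective (n : ℕ) : Function.Injective (permWord (n := n)) := by
  intro π ρ h
  have := List.ofFn_injective h
  ext i
  have := congrFun this i
  simpa using this

theorem permWord_mem_words {n : ℕ} (π : Equiv.Perm (Fin n)) :
    permWord π ∈ words (Finset.Icc 1 n) := by
  rw [mem_words]
  refine ⟨List.nodup_ofFn.2 fun i j h => π.injective (Fin.ext (by simpa using h)), ?_⟩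
  ext a
  simp only [permWord, List.mem_toFinset, List.mem_ofFn, Finset.mem_Icc]
  constructor
  · rintro ⟨i, rfl⟩
    have := (π i).2
    omega
  · intro h
    exact ⟨π.symm ⟨a - 1, by omega⟩, by simp; omega⟩

theorem card_words (S : Finset ℕ) : (words S).card = S.card ! := by
  rw [words, List.toFinset_card_of_nodup (List.nodup_permutations _ S.nodup_toList),
    List.length_permutations, Finset.length_toList]

theorem sum_words_Icc {R : Type*} [AddCommMonoid R] (n : ℕ) (F : List ℕ → R) :
    ∑ l ∈ words (Finset.Icc 1 n), F l = ∑ π : Equiv.Perm (Fin n), F (permWord π) := by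
  have h : (Finset.univ : Finset (Equiv.Perm (Fin n))).image permWord =
      words (Finset.Icc 1 n) := by
    refine Finset.eq_of_subset_of_card_le ?_ ?_
    · intro l hl
      obtain ⟨π, -, rfl⟩ := Finset.mem_image.1 hl
      exact permWord_mem_words π
    · rw [Finset.card_image_of_injective _ (permWord_injective n), card_words]
      simp [Fintype.card_perm]
  rw [← h, Finset.sum_image fun _ _ _ _ e => permWord_injective n e]

variable {R : Type*} [CommSemiring R] (x y : R)

theorem windowWt_eq_prod : ∀ l : List ℕ, windowWt x y l = ∏ i ∈ Finset.range (l.length - 2),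
    centerWt x y (l.getD i 0) (l.getD (i + 1) 0) (l.getD (i + 2) 0)
  | [] => by simp [windowWt]
  | [a] => by simp [windowWt]
  | [a, b] => by simp [windowWt]
  | a :: b :: c :: l => by
      have h : (a :: b :: c :: l).length - 2 = ((b :: c :: l).length - 2) + 1 := by simp
      rw [windowWt_cons_cons_cons, windowWt_eq_prod (b :: c :: l), h, Finset.prod_range_succ',
        mul_comm]
      simp

theorem permWord_getD {n : ℕ} (π : Equiv.Perm (Fin n)) {i : ℕ} (h : i < n) :
    (permWord π).getD i 0 = (π ⟨i, h⟩ : ℕ) + 1 := by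
  rw [List.getD_eq_getElem _ _ (by simpa [permWord] using h)]
  simp [permWord]

theorem prod_centerWt (n : ℕ) (g : ℕ → ℕ) :
    ∏ i ∈ Finset.range n, centerWt x y (g i) (g (i + 1)) (g (i + 2)) =
      x ^ ((Finset.range n).filter fun i => g (i + 2) < g (i + 1) ∧ g i < g (i + 1)).card *
      y ^ ((Finset.range n).filter fun i => g (i + 2) < g (i + 1) ∧ ¬ g i < g (i + 1)).card := by
  rw [← Finset.prod_const, ← Finset.prod_const, Finset.prod_filter, Finset.prod_filter,
    ← Finset.prod_mul_distrib]
  refine Finset.prod_congr rfl fun i _ => ?_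
  rw [centerWt]
  split_ifs <;> simp_all

/-- The initial `0` makes the first position an ordinary case. The bound `n - 1` excludes the last
position, where the default `0` of `getD` would imitate a descent. -/
theorem isExteriorPeak_iff {n : ℕ} (π : Equiv.Perm (Fin n)) (i : Fin n) :
    IsExteriorPeak π i ↔ (i : ℕ) < n - 1 ∧
      (0 :: permWord π).getD (i + 2) 0 < (0 :: permWord π).getD (i + 1) 0 ∧
        (0 :: permWord π).getD i 0 < (0 :: permWord π).getD (i + 1) 0 := by
  obtain ⟨i, hi⟩ := i
  simp only [IsExteriorPeak, List.getD_cons_succ]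
  rw [permWord_getD π hi]
  have h1 : (∃ k : Fin n, (k : ℕ) = i + 1 ∧ π k < π ⟨i, hi⟩) ↔
      i < n - 1 ∧ (permWord π).getD (i + 1) 0 < (π ⟨i, hi⟩ : ℕ) + 1 := by
    constructor
    · rintro ⟨⟨k, hk⟩, rfl, h⟩
      rw [permWord_getD π hk]
      exact ⟨by omega, by simpa using h⟩
    · rintro ⟨h, h'⟩
      rw [permWord_getD π (by omega : i + 1 < n)] at h'
      exact ⟨⟨i + 1, by omega⟩, rfl, by simpa using h'⟩
  have h2 : (∀ k : Fin n, (k : ℕ) + 1 = i → π k < π ⟨i, hi⟩) ↔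
      (0 :: permWord π).getD i 0 < (π ⟨i, hi⟩ : ℕ) + 1 := by
    cases i with
    | zero => simp
    | succ i =>
      rw [List.getD_cons_succ, permWord_getD π (by omega : i < n)]
      constructor
      · intro h
        simpa using h ⟨i, by omega⟩ rfl
      · rintro h ⟨k, hk⟩ e
        obtain rfl : k = i := by simpa using e
        simpa using h
  rw [h1, h2, and_assoc]

theorem isProperDoubleDescent_iff {n : ℕ} (π : Equiv.Perm (Fin n)) (i : Fin n) :
    IsProperDoubleDescent π i ↔ ∃ j < n - 1, j + 1 = (i : ℕ) ∧
      (0 :: permWord π).getD (j + 2) 0 < (0 :: permWord π).getD (j + 1) 0 ∧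
        ¬ (0 :: permWord π).getD j 0 < (0 :: permWord π).getD (j + 1) 0 := by
  constructor
  · rintro ⟨⟨j, hj⟩, ⟨k, hk⟩, e, e', h, h'⟩
    simp only at e e'
    subst e
    refine ⟨k + 1, by omega, e', ?_⟩
    simp only [List.getD_cons_succ]
    rw [permWord_getD π hk, permWord_getD π hj, permWord_getD π (by omega : k + 1 + 1 < n)]
    have hi : i = ⟨k + 1 + 1, by omega⟩ := Fin.ext e'.symm
    rw [hi] at h'
    simp only [Fin.lt_def] at h h'
    omega
  · rintro ⟨j, hj, e, h, h'⟩
    obtain ⟨i, hi⟩ := i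
    obtain rfl : j + 1 = i := e
    cases j with
    -- The window at `0` begins with the added bottom letter, which lies below the first letter, so
    -- it is no double descent.
    | zero =>
      rw [List.getD_cons_succ, permWord_getD π (by omega : 0 < n)] at h'
      simp at h'
    | succ j =>
      simp only [List.getD_cons_succ] at h h'
      rw [permWord_getD π (by omega : j < n), permWord_getD π (by omega : j + 1 < n)] at h'
      rw [permWord_getD π (by omega : j + 1 < n), permWord_getD π (by omega : j + 1 + 1 < n)] at h
      refine ⟨⟨j + 1, by omega⟩, ⟨j, by omega⟩, rfl, rfl, ?_, ?_⟩
      -- The negated inequality leaves equality open; injectivity of `π` excludes it.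
      · have : (π ⟨j, by omega⟩) ≠ π ⟨j + 1, by omega⟩ := fun h => by
          simpa using π.injective h
        have := Fin.val_ne_of_ne this
        rw [Fin.lt_def]
        omega
      · rw [Fin.lt_def]
        omega

theorem openWt_permWord {n : ℕ} (π : Equiv.Perm (Fin n)) :
    openWt x y (permWord π) = x ^ exteriorPeaks π * y ^ properDoubleDescents π := by
  have hl : (0 :: permWord π).length - 2 = n - 1 := by simp [permWord]
  rw [openWt, windowWt_eq_prod, hl, prod_centerWt x y (n - 1) fun i => (0 :: permWord π).getD i 0]
  congr 2
  · rw [exteriorPeaks, ← Finset.card_map Fin.valEmbedding]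
    congr 1
    ext i
    simp only [Finset.mem_filter, Finset.mem_range, Finset.mem_map, Finset.mem_univ, true_and,
      Fin.valEmbedding_apply, isExteriorPeak_iff]
    constructor
    · rintro ⟨h, h'⟩
      exact ⟨⟨i, by omega⟩, ⟨h, h'⟩, rfl⟩
    · rintro ⟨j, h, rfl⟩
      exact h
  -- A peak is recorded at the centre of its window, a double descent at its last letter; hence the
  -- shift by one.
  · rw [properDoubleDescents, ← Finset.card_map Fin.valEmbedding,
      ← Finset.card_map (addRightEmbedding 1)]
    congr 1
    ext i
    simp only [Finset.mem_filter, Finset.mem_range, Finset.mem_map, Finset.mem_univ, true_and,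
      Fin.valEmbedding_apply, isProperDoubleDescent_iff, addRightEmbedding_apply]
    constructor
    · rintro ⟨j, ⟨h, h'⟩, rfl⟩
      exact ⟨⟨j + 1, by omega⟩, ⟨j, h, rfl, h'⟩, rfl⟩
    · rintro ⟨k, ⟨j, h, e, h'⟩, rfl⟩
      exact ⟨j, ⟨h, h'⟩, e⟩

theorem exteriorPeaks_lt {n : ℕ} (π : Equiv.Perm (Fin n)) : exteriorPeaks π < n + 1 :=
  Nat.lt_succ_of_le ((Finset.card_le_univ _).trans (by simp))

theorem properDoubleDescents_lt {n : ℕ} (π : Equiv.Perm (Fin n)) :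
    properDoubleDescents π < n + 1 :=
  Nat.lt_succ_of_le ((Finset.card_le_univ _).trans (by simp))

theorem sum_card_filter_mul {α : Type*} [Fintype α] (f : α → ℕ) {N : ℕ} (hf : ∀ a, f a < N)
    (w : ℕ → R) :
    ∑ k ∈ Finset.range N, ((Finset.univ.filter fun a => f a = k).card : R) * w k =
      ∑ a, w (f a) := by
  rw [← Finset.sum_fiberwise_of_maps_to (s := Finset.univ) (t := Finset.range N) (g := f)
    fun a _ => Finset.mem_range.2 (hf a)]
  refine Finset.sum_congr rfl fun k _ => ?_
  rw [← nsmul_eq_mul, ← Finset.sum_const]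
  exact Finset.sum_congr rfl fun a ha => by rw [(Finset.mem_filter.1 ha).2]

theorem polyT_eq_sum (n : ℕ) : polyT n x = ∑ π : Equiv.Perm (Fin n), x ^ exteriorPeaks π :=
  sum_card_filter_mul _ exteriorPeaks_lt fun k => x ^ k

theorem polyU_eq_sum (n : ℕ) : polyU n y = ∑ π : Equiv.Perm (Fin n), y ^ properDoubleDescents π :=
  sum_card_filter_mul _ properDoubleDescents_lt fun k => y ^ k

theorem polyP_eq_sum (n : ℕ) : polyP n x y =
    ∑ π : Equiv.Perm (Fin n), x ^ exteriorPeaks π * y ^ properDoubleDescents π := by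
  rw [polyP, ← Finset.sum_product', ← Finset.sum_fiberwise_of_maps_to (s := Finset.univ)
    (t := Finset.range (n + 1) ×ˢ Finset.range (n + 1))
    (g := fun π : Equiv.Perm (Fin n) => (exteriorPeaks π, properDoubleDescents π))
    fun π _ => Finset.mem_product.2 ⟨Finset.mem_range.2 (exteriorPeaks_lt π),
      Finset.mem_range.2 (properDoubleDescents_lt π)⟩]
  refine Finset.sum_congr rfl fun k _ => ?_
  simp only [Prod.ext_iff]
  rw [countP, mul_assoc, ← nsmul_eq_mul, ← Finset.sum_const]
  refine Finset.sum_congr rfl fun a ha => ?_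
  rw [(Finset.mem_filter.1 ha).2.1, (Finset.mem_filter.1 ha).2.2]

theorem polyP_one_right (n : ℕ) : polyP n x 1 = polyT n x := by
  simp [polyP_eq_sum, polyT_eq_sum]

theorem polyP_one_left (n : ℕ) : polyP n 1 y = polyU n y := by
  simp [polyP_eq_sum, polyU_eq_sum]

theorem polyP_one_zero (n : ℕ) : polyP n (1 : R) 0 = (countU n 0 : R) := by
  rw [polyP_one_left, polyU, Finset.sum_eq_single_of_mem 0 (by simp)]
  · simp
  · intro b _ hb
    simp [hb]

theorem polyP_eq_openNum {R : Type*} [CommRing R] (x y : R) (n : ℕ) :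
    polyP n x y = openNum x y n := by
  rw [polyP_eq_sum, openNum, openSum, sum_words_Icc]
  exact Finset.sum_congr rfl fun π _ => (openWt_permWord x y π).symm

end Permutations

/-! ### Differential equations for the formal generating functions. -/

section GeneratingFunction

open PowerSeries

variable {K : Type*} [Field K]

/-- The exponential generating function of a sequence. -/
noncomputable def egf (a : ℕ → K) : PowerSeries K := PowerSeries.mk fun n => a n / (n ! : K)

theorem coeff_egf (a : ℕ → K) (n : ℕ) : coeff n (egf a) = a n / (n ! : K) := coeff_mk _ _

theorem constantCoeff_egf (a : ℕ → K) : constantCoeff (egf a) = a 0 := by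
  rw [← coeff_zero_eq_constantCoeff_apply, coeff_egf]; simp

variable [CharZero K]

theorem derivative_egf (a : ℕ → K) : derivative K (egf a) = egf fun n => a (n + 1) := by
  ext n
  rw [coeff_derivative, coeff_egf, coeff_egf, Nat.factorial_succ]
  have h1 : (n ! : K) ≠ 0 := Nat.cast_ne_zero.2 n.factorial_ne_zero
  have h2 : (n : K) + 1 ≠ 0 := Nat.cast_add_one_ne_zero n
  push_cast
  field_simp

theorem egf_mul (a b : ℕ → K) : egf a * egf b =
    egf fun n => ∑ k ∈ Finset.range (n + 1), (n.choose k : K) * (a k * b (n - k)) := by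
  ext n
  rw [coeff_mul, coeff_egf, Finset.Nat.sum_antidiagonal_eq_sum_range_succ_mk, Finset.sum_div]
  refine Finset.sum_congr rfl fun k hk => ?_
  have hk : k ≤ n := Nat.lt_succ_iff.1 (Finset.mem_range.1 hk)
  rw [coeff_egf, coeff_egf, Nat.cast_choose K hk]
  have h1 : (n ! : K) ≠ 0 := Nat.cast_ne_zero.2 n.factorial_ne_zero
  have h2 : (k ! : K) ≠ 0 := Nat.cast_ne_zero.2 k.factorial_ne_zero
  have h3 : ((n - k)! : K) ≠ 0 := Nat.cast_ne_zero.2 (n - k).factorial_ne_zero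
  field_simp

theorem derivative_expSeries (a : K) :
    derivative K (expSeries a) = C a * expSeries a := by
  have : expSeries a = egf fun n => a ^ n := rfl
  rw [this, derivative_egf]
  ext n
  rw [coeff_C_mul, coeff_egf, coeff_egf, pow_succ']
  ring

theorem constantCoeff_expSeries (a : K) : constantCoeff (expSeries a) = 1 := by
  have : expSeries a = egf fun n => a ^ n := rfl
  rw [this, constantCoeff_egf, pow_zero]

/-- A homogeneous linear differential equation with zero initial value has only the zero
solution. -/
theorem eq_zero_of_derivative_eq_mul {f g : PowerSeries K} (h : derivative K f = g * f)
    (h0 : constantCoeff f = 0) : f = 0 := by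
  ext n
  rw [map_zero]
  induction n using Nat.strong_induction_on with
  | _ n ih =>
    cases n with
    | zero => simpa using h0
    | succ n =>
      have e := congrArg (coeff n) h
      rw [coeff_derivative, coeff_mul] at e
      -- The coefficient of `g * f` at `n` involves only coefficients of `f` up to `n`, which vanish
      -- by induction; characteristic zero permits the division by `n + 1`.
      rw [Finset.sum_eq_zero] at e
      · exact (mul_eq_zero.1 e).resolve_right (Nat.cast_add_one_ne_zero n)
      · intro p hp
        rw [ih p.2 (by have := Finset.HasAntidiagonal.mem_antidiagonal.1 hp; omega), mul_zero]

variable (x y : K)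

theorem derivative_egf_openNum : derivative K (egf (openNum x y)) =
    egf (closedNum x y) * egf (openNum x y) := by
  rw [derivative_egf, egf_mul]
  simp only [openNum_succ]

theorem derivative_egf_closedNum : derivative K (egf (closedNum x y)) =
    egf (closedNum x y) ^ 2 - C (1 - y) * egf (closedNum x y) + C (x - y) := by
  rw [derivative_egf, sq, egf_mul]
  ext n
  rw [map_add, map_sub, coeff_C_mul, coeff_C, coeff_egf, coeff_egf, coeff_egf, closedNum_succ]
  by_cases hn : n = 0
  · simp [hn]
  · simp only [hn, if_false]
    ring

variable {x y} {Δ : K}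

/-- The denominator of the generating function. -/
noncomputable def denomSeries (y Δ : K) : PowerSeries K :=
  C (1 + y + Δ) - C (1 + y - Δ) * expSeries Δ

theorem constantCoeff_denomSeries (y Δ : K) : constantCoeff (denomSeries y Δ) = 2 * Δ := by
  simp [denomSeries, constantCoeff_expSeries]
  ring

theorem derivative_denomSeries (y Δ : K) :
    derivative K (denomSeries y Δ) = -(C (Δ * (1 + y - Δ)) * expSeries Δ) := by
  rw [denomSeries, map_sub, derivative_C, Derivation.leibniz, derivative_C, derivative_expSeries]
  simp only [smul_eq_mul, map_mul]
  ring

/-- The right-hand side is `-D'` for `D = denomSeries y Δ`: this is the linearization `C - r = -D' /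
D` of the Riccati equation, cleared of denominators. -/
theorem egf_closedNum_mul_denomSeries (h : Δ ^ 2 = (1 + y) ^ 2 - 4 * x) :
    (egf (closedNum x y) - C ((1 - y + Δ) / 2)) * denomSeries y Δ =
      C (Δ * (1 + y - Δ)) * expSeries Δ := by
  rw [← sub_eq_zero]
  set r := (1 - y + Δ) / 2 with hr
  -- The discriminant of this quadratic is `(1 - y)² - 4(x - y) = (1 + y)² - 4x = Δ²`.
  have hroot : r ^ 2 - (1 - y) * r + (x - y) = 0 := by
    rw [hr]; linear_combination h / 4
  have h2 : 1 - y = 2 * r - Δ := by rw [hr]; ring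
  have hV : derivative K (egf (closedNum x y) - C r) =
      (egf (closedNum x y) - C r) * (egf (closedNum x y) - C r + C Δ) := by
    have hC : (C r : PowerSeries K) ^ 2 - C (1 - y) * C r + C (x - y) = 0 := by
      rw [← map_pow, ← map_mul, ← map_sub, ← map_add, hroot, map_zero]
    have hC2 : (C (1 - y) : PowerSeries K) = 2 * C r - C Δ := by
      rw [h2, map_sub, map_mul, map_ofNat]
    rw [map_sub, derivative_C, derivative_egf_closedNum]
    rw [hC2] at hC ⊢
    linear_combination hC
  -- With `V = C - r` one has `V' = V (V + Δ)` and `D'' = Δ D'`, so `V D + D'` is multiplied by `V +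
  -- Δ` under differentiation.
  refine eq_zero_of_derivative_eq_mul (g := egf (closedNum x y) - C r + C Δ) ?_ ?_
  · rw [map_sub, Derivation.leibniz, Derivation.leibniz, hV, derivative_denomSeries, derivative_C,
      derivative_expSeries]
    simp only [smul_eq_mul]
    ring
  · rw [map_sub, map_mul, map_sub, map_mul, constantCoeff_egf, constantCoeff_denomSeries,
      constantCoeff_expSeries, closedNum_zero]
    simp only [constantCoeff_C]
    rw [hr]
    ring

/-- By `O' = C O` and `(C - r) D = -D'`, the product `O D` has derivative `r O D`, the equation of
`e^{rt}`; its initial value is `D(0) = 2Δ`. -/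
theorem egf_openNum_mul_denomSeries (h : Δ ^ 2 = (1 + y) ^ 2 - 4 * x) :
    egf (openNum x y) * denomSeries y Δ = C (2 * Δ) * expSeries ((1 - y + Δ) / 2) := by
  rw [← sub_eq_zero]
  refine eq_zero_of_derivative_eq_mul (g := C ((1 - y + Δ) / 2)) ?_ ?_
  · rw [map_sub, Derivation.leibniz, Derivation.leibniz, derivative_egf_openNum,
      derivative_denomSeries, derivative_C, derivative_expSeries]
    simp only [smul_eq_mul]
    linear_combination egf (openNum x y) * egf_closedNum_mul_denomSeries h
  · rw [map_sub, map_mul, map_mul, constantCoeff_egf, constantCoeff_denomSeries,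
      constantCoeff_expSeries, openNum_zero]
    simp

theorem egf_polyP_mul_denomSeries (h : Δ ^ 2 = (1 + y) ^ 2 - 4 * x) :
    egf (fun n => polyP n x y) * denomSeries y Δ =
      C (2 * Δ) * expSeries ((1 - y + Δ) / 2) := by
  simp only [polyP_eq_openNum]
  exact egf_openNum_mul_denomSeries h

theorem isUnit_denomSeries (hΔ : Δ ≠ 0) : IsUnit (denomSeries y Δ) := by
  rw [PowerSeries.isUnit_iff_constantCoeff, constantCoeff_denomSeries]
  exact (mul_ne_zero two_ne_zero hΔ).isUnit

theorem egf_polyP_eq (h : Δ ^ 2 = (1 + y) ^ 2 - 4 * x) (hΔ : Δ ≠ 0) :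
    egf (fun n => polyP n x y) =
      C (2 * Δ) * expSeries ((1 - y + Δ) / 2) * (denomSeries y Δ)⁻¹ := by
  rw [PowerSeries.eq_mul_inv_iff_mul_eq, egf_polyP_mul_denomSeries h]
  rw [constantCoeff_denomSeries]
  exact mul_ne_zero two_ne_zero hΔ

end GeneratingFunction

/-! ### Convergence near zero and the classical special cases. -/

section Evaluation

open PowerSeries

/-- The power series `f` converges absolutely at `t`, with the sum `v`. -/
def HasAbsSum (f : PowerSeries ℂ) (t v : ℂ) : Prop :=
  Summable (fun n => ‖coeff n f * t ^ n‖) ∧ HasSum (fun n => coeff n f * t ^ n) v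

theorem HasAbsSum.sub {f g : PowerSeries ℂ} {t v w : ℂ} (hf : HasAbsSum f t v) (hg : HasAbsSum g t w) :
    HasAbsSum (f - g) t (v - w) := by
  refine ⟨(hf.1.add hg.1).of_nonneg_of_le (fun _ => norm_nonneg _) fun n => ?_, ?_⟩
  · rw [map_sub, sub_mul]
    exact norm_sub_le _ _
  · simpa only [map_sub, sub_mul] using hf.2.sub hg.2

theorem HasAbsSum.mul {f g : PowerSeries ℂ} {t v w : ℂ} (hf : HasAbsSum f t v) (hg : HasAbsSum g t w) :
    HasAbsSum (f * g) t (v * w) := by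
  have e : ∀ n, coeff n (f * g) * t ^ n = ∑ kl ∈ Finset.HasAntidiagonal.antidiagonal n,
      coeff kl.1 f * t ^ kl.1 * (coeff kl.2 g * t ^ kl.2) := by
    intro n
    rw [coeff_mul, Finset.sum_mul]
    refine Finset.sum_congr rfl fun kl h => ?_
    rw [← Finset.HasAntidiagonal.mem_antidiagonal.1 h, pow_add]
    ring
  have hs := summable_norm_sum_mul_antidiagonal_of_summable_norm hf.1 hg.1
  simp only [HasAbsSum, e]
  refine ⟨hs, ?_⟩
  rw [← hf.2.tsum_eq, ← hg.2.tsum_eq,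
    tsum_mul_tsum_eq_tsum_sum_antidiagonal_of_summable_norm hf.1 hg.1]
  exact hs.of_norm.hasSum

theorem hasAbsSum_C (a t : ℂ) : HasAbsSum (C a) t a := by
  have h : ∀ n ≠ 0, coeff n (C a) * t ^ n = 0 := fun n hn => by simp [coeff_C, hn]
  refine ⟨summable_of_ne_finset_zero (s := {0}) fun n hn => ?_, ?_⟩
  · rw [h n (by simpa using hn), norm_zero]
  · simpa using hasSum_single 0 h

theorem hasAbsSum_expSeries (a t : ℂ) : HasAbsSum (expSeries a) t (Complex.exp (t * a)) := by
  have e : ∀ n, coeff n (expSeries a) * t ^ n = (t * a) ^ n / (n ! : ℂ) := by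
    intro n
    rw [expSeries, coeff_mk, mul_pow]
    ring
  simp only [HasAbsSum, e, Complex.exp_eq_exp_ℂ]
  exact ⟨NormedSpace.norm_expSeries_div_summable _, NormedSpace.expSeries_div_hasSum_exp _⟩

/-- There are `n !` monomials with both exponents at most `n`; the maximum with `1` covers the
smaller exponents. The bound gives a positive radius of convergence. -/
theorem norm_polyP_le (n : ℕ) (x y : ℂ) :
    ‖polyP n x y‖ ≤ n ! * (max 1 ‖x‖ * max 1 ‖y‖) ^ n := by
  rw [polyP_eq_sum]
  refine (norm_sum_le_of_le (f := fun π : Equiv.Perm (Fin n) =>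
    x ^ exteriorPeaks π * y ^ properDoubleDescents π) _
    (n := fun _ => (max 1 ‖x‖ * max 1 ‖y‖) ^ n) fun π _ => ?_).trans ?_
  · have h : ∀ (z : ℂ) {k : ℕ}, k < n + 1 → ‖z‖ ^ k ≤ max 1 ‖z‖ ^ n := fun z k hk =>
      (pow_le_pow_left₀ (norm_nonneg z) (le_max_right _ _) k).trans
        (pow_le_pow_right₀ (le_max_left _ _) (Nat.lt_succ_iff.1 hk))
    rw [norm_mul, norm_pow, norm_pow, mul_pow]
    exact mul_le_mul (h x (exteriorPeaks_lt π)) (h y (properDoubleDescents_lt π)) (by positivity)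
      (by positivity)
  · simp [Fintype.card_perm]

theorem summable_egf_polyP {x y t : ℂ} (ht : max 1 ‖x‖ * max 1 ‖y‖ * ‖t‖ < 1) :
    Summable fun n => ‖coeff n (egf fun n => polyP n x y) * t ^ n‖ := by
  refine (summable_geometric_of_lt_one (by positivity) ht).of_nonneg_of_le
    (fun _ => norm_nonneg _) fun n => ?_
  have h : (0 : ℝ) < n ! := by exact_mod_cast n.factorial_pos
  rw [coeff_egf, norm_mul, norm_div, norm_pow, Complex.norm_natCast, mul_pow]
  refine mul_le_mul_of_nonneg_right ?_ (by positivity)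
  rw [div_le_iff₀ h, mul_comm]
  exact norm_polyP_le n x y

/-- The exponential generating function of `polyP n x y` as a convergent series near `0`. -/
theorem eventually_hasSum_polyP {x y Δ : ℂ} (h : Δ ^ 2 = (1 + y) ^ 2 - 4 * x) (hΔ : Δ ≠ 0) :
    ∀ᶠ t in 𝓝 (0 : ℂ), 1 + y + Δ - (1 + y - Δ) * Complex.exp (t * Δ) ≠ 0 ∧
      HasSum (fun n : ℕ => polyP n x y * (t ^ n / (n ! : ℂ)))
        (2 * Δ * Complex.exp (t / 2 * (1 - y + Δ)) /
          (1 + y + Δ - (1 + y - Δ) * Complex.exp (t * Δ))) := by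
  have h1 : ∀ᶠ t in 𝓝 (0 : ℂ), 1 + y + Δ - (1 + y - Δ) * Complex.exp (t * Δ) ≠ 0 := by
    refine ContinuousAt.eventually_ne (by fun_prop) ?_
    simpa [← two_mul] using hΔ
  have h2 : ∀ᶠ t in 𝓝 (0 : ℂ), max 1 ‖x‖ * max 1 ‖y‖ * ‖t‖ < 1 := by
    refine ContinuousAt.eventually_lt (by fun_prop) continuousAt_const ?_
    simp
  filter_upwards [h1, h2] with t ht1 ht2
  refine ⟨ht1, ?_⟩
  have hs := summable_egf_polyP ht2
  have hP : HasAbsSum (egf fun n => polyP n x y) t _ := ⟨hs, hs.of_norm.hasSum⟩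
  have hD : HasAbsSum (denomSeries y Δ) t _ :=
    (hasAbsSum_C (1 + y + Δ) t).sub ((hasAbsSum_C (1 + y - Δ) t).mul (hasAbsSum_expSeries Δ t))
  have hN := (hasAbsSum_C (2 * Δ) t).mul (hasAbsSum_expSeries ((1 - y + Δ) / 2) t)
  have hPD := hP.mul hD
  -- The product with the denominator has now two sums, one from the Cauchy product and one from the
  -- formal identity; uniqueness of the sum equates them.
  rw [egf_polyP_mul_denomSeries h] at hPD
  have e := (eq_div_iff ht1).2 (hPD.2.unique hN.2)
  have e2 : t / 2 * (1 - y + Δ) = t * ((1 - y + Δ) / 2) := by ring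
  rw [e2, ← e]
  convert hP.2 using 2 with n
  rw [coeff_egf]
  ring

theorem eventually_hasSum_polyT {x s : ℂ} (h : s ^ 2 = 1 - x) (hs : s ≠ 0) :
    ∀ᶠ t in 𝓝 (0 : ℂ), s * Complex.cosh (t * s) - Complex.sinh (t * s) ≠ 0 ∧
      HasSum (fun n : ℕ => polyT n x * t ^ n / (n ! : ℂ))
        (s / (s * Complex.cosh (t * s) - Complex.sinh (t * s))) := by
  -- At `y = 1` the root is `Δ = 2s`, and the factor `4 e^{ts}` of the denominator leaves the
  -- hyperbolic form.
  have h1 : (2 * s) ^ 2 = (1 + 1) ^ 2 - 4 * x := by linear_combination 4 * h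
  filter_upwards [eventually_hasSum_polyP h1 (mul_ne_zero two_ne_zero hs)] with t ⟨hD, ht⟩
  have e1 : Complex.exp (t * (2 * s)) = Complex.exp (t * s) * Complex.exp (t * s) := by
    rw [← Complex.exp_add]; ring_nf
  have e2 : Complex.exp (t / 2 * (1 - 1 + 2 * s)) = Complex.exp (t * s) := by ring_nf
  have e3 : Complex.exp (t * s) * Complex.exp (-(t * s)) = 1 := by
    rw [← Complex.exp_add]; simp
  have hE := Complex.exp_ne_zero (t * s)
  rw [Complex.cosh, Complex.sinh]
  rw [e1, e2] at ht
  rw [e1] at hD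
  generalize Complex.exp (t * s) = E at *
  generalize Complex.exp (-(t * s)) = E' at *
  have e4 : 1 + 1 + 2 * s - (1 + 1 - 2 * s) * (E * E) =
      4 * E * (s * ((E + E') / 2) - (E - E') / 2) := by
    linear_combination (-2 - 2 * s) * e3
  rw [e4] at hD ht
  have hD' := right_ne_zero_of_mul hD
  refine ⟨hD', ?_⟩
  convert ht using 1
  · funext n
    rw [polyP_one_right, mul_div_assoc]
  · field_simp
    norm_num

theorem eventually_hasSum_polyU {y δ : ℂ} (h : δ ^ 2 = (y - 1) * (y + 3)) (hδ : δ ≠ 0) :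
    ∀ᶠ t in 𝓝 (0 : ℂ), 1 + y + δ - (1 + y - δ) * Complex.exp (t * δ) ≠ 0 ∧
      HasSum (fun n : ℕ => polyU n y * t ^ n / (n ! : ℂ))
        (2 * δ * Complex.exp (t / 2 * (1 - y + δ)) /
          (1 + y + δ - (1 + y - δ) * Complex.exp (t * δ))) := by
  have h1 : δ ^ 2 = (1 + y) ^ 2 - 4 * 1 := by linear_combination h
  filter_upwards [eventually_hasSum_polyP h1 hδ] with t ht
  simpa only [polyP_one_left, mul_div_assoc] using ht

theorem eventually_hasSum_countU_zero :
    ∀ᶠ t in 𝓝 (0 : ℂ), Complex.cos ((√3 : ℝ) * t / 2 + (Real.pi : ℝ) / 6) ≠ 0 ∧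
      HasSum (fun n : ℕ => (countU n 0 : ℂ) * (t ^ n / (n ! : ℂ)))
        ((√3 : ℝ) / 2 * (Complex.exp (t / 2) /
          Complex.cos ((√3 : ℝ) * t / 2 + (Real.pi : ℝ) / 6))) := by
  have hq : ((√3 : ℝ) : ℂ) ^ 2 = 3 := by
    rw [← Complex.ofReal_pow, Real.sq_sqrt (by norm_num)]; norm_num
  have hc : Complex.cos ((Real.pi : ℝ) / 6) = (√3 : ℝ) / 2 := by
    have := congrArg Complex.ofReal Real.cos_pi_div_six
    push_cast at this ⊢
    exact this
  have hsn : Complex.sin ((Real.pi : ℝ) / 6) = 1 / 2 := by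
    have := congrArg Complex.ofReal Real.sin_pi_div_six
    push_cast at this ⊢
    exact this
  have hI := Complex.I_sq
  rw [← sub_eq_zero] at hq
  set q : ℂ := ((√3 : ℝ) : ℂ) with hqdef
  have hq0 : q ≠ 0 := by
    intro h0
    rw [h0] at hq
    norm_num at hq
  -- At `x = 1`, `y = 0` one has `Δ² = -3`, so `Δ = i√3`; the denominator becomes `4i e^{i√3t/2}`
  -- times the cosine.
  have h1 : (Complex.I * q) ^ 2 = (1 + 0) ^ 2 - 4 * 1 := by
    linear_combination q ^ 2 * hI - hq
  filter_upwards [eventually_hasSum_polyP h1 (mul_ne_zero Complex.I_ne_zero hq0)] with t ⟨hD, ht⟩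
  have e1 : Complex.exp (t * (Complex.I * q)) =
      Complex.exp (q * t / 2 * Complex.I) * Complex.exp (q * t / 2 * Complex.I) := by
    rw [← Complex.exp_add]; ring_nf
  have e2 : Complex.exp (t / 2 * (1 - 0 + Complex.I * q)) =
      Complex.exp (t / 2) * Complex.exp (q * t / 2 * Complex.I) := by
    rw [← Complex.exp_add]; ring_nf
  have e3 : Complex.exp (q * t / 2 * Complex.I) * Complex.exp (-(q * t / 2) * Complex.I) = 1 := by
    rw [← Complex.exp_add]; simp
  have hE := Complex.exp_ne_zero (q * t / 2 * Complex.I)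
  rw [Complex.cos_add, hc, hsn, Complex.cos, Complex.sin]
  rw [e1, e2] at ht
  rw [e1] at hD
  generalize Complex.exp (q * t / 2 * Complex.I) = E at *
  generalize Complex.exp (-(q * t / 2) * Complex.I) = E' at *
  have e4 : 1 + 0 + Complex.I * q - (1 + 0 - Complex.I * q) * (E * E) =
      4 * Complex.I * E * ((E + E') / 2 * (q / 2) - (E' - E) * Complex.I / 2 * (1 / 2)) := by
    linear_combination (-Complex.I * q - 1) * e3 + (E * E' - E * E) * hI
  rw [e4] at hD ht
  have hD' := right_ne_zero_of_mul hD
  refine ⟨hD', ?_⟩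
  convert ht using 1
  · funext n
    rw [polyP_one_zero]
  · generalize (E + E') / 2 * (q / 2) - (E' - E) * Complex.I / 2 * (1 / 2) = W at *
    have := Complex.I_ne_zero
    field_simp
    norm_num

end Evaluation
theorem mainTheorem5 :
    -- the identity of formal power series in `t`, for elements of any field of characteristic 0
    -- (in particular for indeterminates `x`, `y` and a square root of `(1 + y)^2 - 4 x`)
    (∀ (K : Type*) [Field K] [CharZero K] (x y Δ : K), Δ ^ 2 = (1 + y) ^ 2 - 4 * x → Δ ≠ 0 →
      IsUnit (PowerSeries.C (1 + y + Δ) - PowerSeries.C (1 + y - Δ) * expSeries Δ) ∧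
      PowerSeries.mk (fun n => polyP n x y / (n ! : K)) =
        PowerSeries.C (2 * Δ) * expSeries ((1 - y + Δ) / 2) *
          (PowerSeries.C (1 + y + Δ) - PowerSeries.C (1 + y - Δ) * expSeries Δ)⁻¹) ∧
    -- the same identity for complex numbers, as a convergent series in `t` near `0`
    (∀ x y Δ : ℂ, Δ ^ 2 = (1 + y) ^ 2 - 4 * x → Δ ≠ 0 → ∀ᶠ t in 𝓝 (0 : ℂ),
      1 + y + Δ - (1 + y - Δ) * Complex.exp (t * Δ) ≠ 0 ∧
      HasSum (fun n : ℕ => polyP n x y * (t ^ n / (n ! : ℂ)))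
        (2 * Δ * Complex.exp (t / 2 * (1 - y + Δ)) /
          (1 + y + Δ - (1 + y - Δ) * Complex.exp (t * Δ)))) ∧
    -- the specializations of the polynomials
    (∀ (R : Type*) [CommSemiring R] (n : ℕ),
      (∀ x : R, polyP n x 1 = polyT n x) ∧ (∀ y : R, polyP n 1 y = polyU n y) ∧
        polyP n (1 : R) 0 = (countU n 0 : R)) ∧
    -- Gessel's formula (`y = 1`)
    (∀ x s : ℂ, s ^ 2 = 1 - x → s ≠ 0 → ∀ᶠ t in 𝓝 (0 : ℂ),
      s * Complex.cosh (t * s) - Complex.sinh (t * s) ≠ 0 ∧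
      HasSum (fun n : ℕ => polyT n x * t ^ n / (n ! : ℂ))
        (s / (s * Complex.cosh (t * s) - Complex.sinh (t * s)))) ∧
    -- the formula of Elizalde and Noy (`x = 1`)
    (∀ y δ : ℂ, δ ^ 2 = (y - 1) * (y + 3) → δ ≠ 0 → ∀ᶠ t in 𝓝 (0 : ℂ),
      1 + y + δ - (1 + y - δ) * Complex.exp (t * δ) ≠ 0 ∧
      HasSum (fun n : ℕ => polyU n y * t ^ n / (n ! : ℂ))
        (2 * δ * Complex.exp (t / 2 * (1 - y + δ)) /
          (1 + y + δ - (1 + y - δ) * Complex.exp (t * δ)))) ∧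
    -- the formula of Elizalde and Noy, Barry, and Basset (`x = 1`, `y = 0`)
    (∀ᶠ t in 𝓝 (0 : ℂ),
      Complex.cos ((√3 : ℝ) * t / 2 + (Real.pi : ℝ) / 6) ≠ 0 ∧
      HasSum (fun n : ℕ => (countU n 0 : ℂ) * (t ^ n / (n ! : ℂ)))
        ((√3 : ℝ) / 2 * (Complex.exp (t / 2) /
          Complex.cos ((√3 : ℝ) * t / 2 + (Real.pi : ℝ) / 6)))) := by
  exact ⟨fun K _ _ x y Δ h hΔ => ⟨isUnit_denomSeries hΔ, egf_polyP_eq h hΔ⟩,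
    fun x y Δ h hΔ => eventually_hasSum_polyP h hΔ,
    fun R _ n => ⟨fun x => polyP_one_right x n, fun y => polyP_one_left y n, polyP_one_zero n⟩,
    fun x s h hs => eventually_hasSum_polyT h hs,
    fun y δ h hδ => eventually_hasSum_polyU h hδ,
    eventually_hasSum_countU_zero⟩
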